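/- In this statement multigraphs may have self-loops and multiple edges, and a self-loop contributes $2$ to the degree of its vertex. A bridge is an edge whose removal (keeping all vertices) disconnects the graph, and a multigraph is bridgeless if it has no bridge. A degree-$2$ subgraph of $G$ is a subgraph $\gamma=(V_\gamma,E_\gamma)$ of $G$, not necessarily spanning, induced or connected, in which every vertex of $V_\gamma$ has degree exactly $2$. Let $G=(V,E)$ be a finite, connected, bridgeless multigraph with maximum degree $d$, where $d\ge 3$ is odd, and let $$I=\{v\in V:\deg_G(v)<d\}.$$ Then for every $v\in I$ there exist two degree-$2$ subgraphs $\gamma_1,\gamma_2$ of $G$ such that $v\in V_{\gamma_1}$, $v\notin V_{\gamma_2}$, and $V\setminus I\subseteq V_{\gamma_1}$, $V\setminus I\subseteq V_{\gamma_2}$. -/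

import Mathlib

open scoped Graph

/-! Multigraphs are Mathlib's `Graph α β`: a set `V(G)` of vertices and a set `E(G)` of edges, where
self-loops and several edges between the same two vertices are allowed. -/

namespace Graph

/-- The degree of `v`: the number of edges at `v`, where a self-loop counts twice
(every edge at `v` is counted once, and every self-loop at `v` once more). -/
noncomputable def degree {α β : Type*} (G : Graph α β) (v : α) : ℕ :=
  (G.incidenceSet v).ncard + (G.loopSet v).ncard

/-- There is a walk in `G` from `u` to `v` (or `u = v`). -/
def Reachable {α β : Type*} (G : Graph α β) (u v : α) : Prop :=
  Relation.ReflTransGen G.Adj u v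

/-- `G` is connected: it has a vertex, and any two vertices are joined by a walk. -/
def Connected {α β : Type*} (G : Graph α β) : Prop :=
  V(G).Nonempty ∧ ∀ u ∈ V(G), ∀ v ∈ V(G), G.Reachable u v

/-- A bridge is an edge whose removal (all vertices are kept) separates two vertices that were
joined by a walk. -/
def IsBridge {α β : Type*} (G : Graph α β) (e : β) : Prop :=
  e ∈ E(G) ∧ ∃ u ∈ V(G), ∃ v ∈ V(G), G.Reachable u v ∧ ¬ (G.deleteEdges {e}).Reachable u v

/-- `G` has no bridge. -/
def Bridgeless {α β : Type*} (G : Graph α β) : Prop :=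
  ∀ e, ¬ G.IsBridge e

/-- `d` is the maximum degree of `G`: it bounds all degrees of vertices and is attained. -/
def HasMaxDegree {α β : Type*} (G : Graph α β) (d : ℕ) : Prop :=
  IsGreatest (G.degree '' V(G)) d

/-- The set of the vertices of `G` of degree less than `d`. -/
def lowDegreeSet {α β : Type*} (G : Graph α β) (d : ℕ) : Set α :=
  {v | v ∈ V(G) ∧ G.degree v < d}

/-- `H` is a degree-`k` subgraph of `G`: a subgraph (not necessarily spanning or induced) in which
every vertex has degree `k`. -/
def IsDegreeSubgraph {α β : Type*} (H : Graph α β) (k : ℕ) (G : Graph α β) : Prop :=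
  H ≤ G ∧ ∀ v ∈ V(H), H.degree v = k

end Graph

/-! The subgraphs come from perfect matchings of a gadget graph: each vertex becomes two adjacent
copies, each edge two adjacent halves, and each half is adjacent to both copies of its end. Given a
perfect matching, keep the edges whose halves are not matched together and the vertices whose copies
are not; every kept vertex then has degree 2.

The weights 1 - deg v / d between copies, 1 / d between halves and copies, and 1 - 2 / d between
halves sum to 1 at every gadget vertex, and bridgelessness makes every odd cut weigh at least 1
(`one_le_cut_factorGadgetWeight`). As in Edmonds' perfect matching polytope, every edge of positive
weight then lies in a perfect matching using only positive weights; `exists_involution_of_weight`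
derives this from Tutte's theorem.

The copies of a vertex of degree d are joined with weight 0, so such a vertex is always kept. If deg
v < d, forcing the edge between the copies of v omits v, while forcing an edge from a copy of v to a
half-edge keeps it. -/

namespace SimpleGraph

open Finset

/-! ### Perfect matchings from fractional ones, via Tutte's theorem. -/

/-- If a nonnegative edge weighting has all degrees at most `1` and has total at most
`#C - 1` on every odd set `C`, then its total is at most the number of vertices minus
the number of odd components. -/
theorem sum_weight_add_ncard_oddComponents_le {V : Type*} [Fintype V] (G : SimpleGraph V)
    (w : V → V → ℚ) (hpos : ∀ x y, 0 ≤ w x y) (hrow : ∀ x, ∑ y, w x y ≤ 1)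
    (hadj : ∀ x y, w x y ≠ 0 → G.Adj x y)
    (hodd : ∀ C : Finset V, Odd #C → ∑ x ∈ C, ∑ y ∈ C, w x y ≤ #C - 1) :
    ∑ x, ∑ y, w x y + G.oddComponents.ncard ≤ Fintype.card V := by
  classical
  let S : G.ConnectedComponent → Finset V :=
    fun K => {x | G.connectedComponentMk x = K}
  have hS : ∀ K : G.ConnectedComponent, (K.supp : Set V).ncard = #(S K) := by
    intro K
    rw [← Set.ncard_coe_finset]
    congr 1
    ext x
    simp [S]
  have h1 : ∑ x, ∑ y, w x y = ∑ K, ∑ x ∈ S K, ∑ y ∈ S K, w x y := by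
    rw [← Finset.sum_fiberwise univ G.connectedComponentMk]
    refine sum_congr rfl fun K _ => sum_congr rfl fun x hx => ?_
    symm
    refine sum_subset (subset_univ _) fun y _ hy => ?_
    by_contra hne
    apply hy
    have := ConnectedComponent.connectedComponentMk_eq_of_adj (hadj x y hne)
    simp only [mem_filter, mem_univ, true_and, S] at hx ⊢
    rw [← this, hx]
  have h2 : (Fintype.card V : ℚ) = ∑ K, (#(S K) : ℚ) := by
    rw [← Nat.cast_sum, ← card_univ]
    congr 1
    exact card_eq_sum_card_fiberwise (fun x _ => mem_univ (G.connectedComponentMk x))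
  have h3 : (G.oddComponents.ncard : ℚ) = ∑ K, if Odd #(S K) then (1 : ℚ) else 0 := by
    rw [Finset.sum_boole, ← Set.ncard_coe_finset]
    congr 2
    ext K
    simp [oddComponents, hS]
  rw [h1, h2, h3, ← sum_add_distrib]
  refine sum_le_sum fun K _ => ?_
  split_ifs with h
  · linarith [hodd _ h]
  · rw [add_zero]
    calc ∑ x ∈ S K, ∑ y ∈ S K, w x y ≤ ∑ x ∈ S K, (1 : ℚ) :=
          sum_le_sum fun x _ => (sum_le_sum_of_subset_of_nonneg (subset_univ _)
            fun y _ _ => hpos x y).trans (hrow x)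
      _ = _ := by simp

/-- A weighted sufficient condition for a perfect matching: a fractional matching that satisfies
the odd set inequalities and is less than one edge away from being perfect. -/
theorem exists_isPerfectMatching_of_weight {V : Type*} [Fintype V] (G : SimpleGraph V)
    (heven : Even (Fintype.card V))
    (w : V → V → ℚ) (hsymm : ∀ x y, w x y = w y x) (hpos : ∀ x y, 0 ≤ w x y)
    (hrow : ∀ x, ∑ y, w x y ≤ 1) (hadj : ∀ x y, w x y ≠ 0 → G.Adj x y)
    (hodd : ∀ C : Finset V, Odd #C → ∑ x ∈ C, ∑ y ∈ C, w x y ≤ #C - 1)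
    (htotal : (Fintype.card V : ℚ) - 2 < ∑ x, ∑ y, w x y) :
    ∃ M : G.Subgraph, M.IsPerfectMatching := by
  classical
  rw [tutte]
  intro u hu
  rw [IsTutteViolator] at hu
  set H := ((⊤ : G.Subgraph).deleteVerts u) with hH
  have hverts : ∀ x, x ∈ H.verts ↔ x ∉ u := by simp [hH]
  have : Fintype H.verts := Fintype.ofFinite _
  set U : Finset V := u.toFinset with hU
  have hUc : u.ncard = #U := Set.ncard_eq_toFinset_card' u
  have hcard : Fintype.card H.verts + #U = Fintype.card V := by
    have h : Fintype.card H.verts = #Uᶜ := by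
      apply Fintype.card_of_subtype
      intro x
      simp [hU, hverts]
    rw [h, card_compl]
    have := card_le_univ U
    omega
  have hsub : ∀ f : V → ℚ, ∑ x : H.verts, f x = ∑ x ∈ Uᶜ, f x := by
    intro f
    symm
    apply Finset.sum_subtype
    intro x
    simp [hU, hverts]
  have hpar := H.coe.odd_ncard_oddComponents
  rw [Nat.card_eq_fintype_card] at hpar
  -- The number of odd components has the parity of #U because the graph has even order, so
  -- exceeding #U means exceeding it by at least 2.
  have hq : #U + 2 ≤ H.coe.oddComponents.ncard := by
    rw [hUc] at hu
    rcases Nat.even_or_odd H.coe.oddComponents.ncard with h | h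
    · have h' : ¬ Odd (Fintype.card H.verts) := by
        rw [← hpar]; exact Nat.not_odd_iff_even.2 h
      grind
    · have h' := hpar.1 h
      grind
  have key := H.coe.sum_weight_add_ncard_oddComponents_le (fun x y => w x y)
    (fun x y => hpos x y)
    (fun x => by
      rw [hsub (fun y => w x y)]
      exact (sum_le_sum_of_subset_of_nonneg (subset_univ _) fun y _ _ => hpos x y).trans (hrow x))
    (fun x y hxy => by
      have h1 := hadj x y hxy
      have hx := (hverts _).1 x.2
      have hy := (hverts _).1 y.2
      simp [hH, h1, hx, hy])
    (fun C hC => by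
      have := hodd (C.map (Function.Embedding.subtype _)) (by simpa using hC)
      simpa using this)
  have h1 : ∑ x : H.verts, ∑ y : H.verts, w x y = ∑ x ∈ Uᶜ, ∑ y ∈ Uᶜ, w x y := by
    rw [← hsub (fun x => ∑ y ∈ Uᶜ, w x y)]
    exact sum_congr rfl fun x _ => hsub (fun y => w x y)
  have h2 : ∑ x ∈ U, ∑ y, w x y ≤ #U := by
    calc _ ≤ ∑ x ∈ U, (1 : ℚ) := sum_le_sum fun x _ => hrow x
      _ = _ := by simp
  have h3 : ∑ x ∈ Uᶜ, ∑ y ∈ U, w x y ≤ #U := by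
    rw [sum_comm]
    refine le_trans (sum_le_sum fun y _ => ?_) h2
    simp_rw [hsymm _ y]
    exact sum_le_sum_of_subset_of_nonneg (subset_univ _) fun x _ _ => hpos y x
  have h4 : ∑ x, ∑ y, w x y
      = ∑ x ∈ U, ∑ y, w x y + (∑ x ∈ Uᶜ, ∑ y ∈ U, w x y + ∑ x ∈ Uᶜ, ∑ y ∈ Uᶜ, w x y) := by
    rw [← sum_add_distrib, ← sum_add_sum_compl U]
    congr 1
    exact sum_congr rfl fun x _ => (sum_add_sum_compl U _).symm
  rw [h1] at key
  have hq' : (#U : ℚ) + 2 ≤ H.coe.oddComponents.ncard := by exact_mod_cast hq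
  have hcard' : (Fintype.card H.verts : ℚ) + #U = Fintype.card V := by exact_mod_cast hcard
  -- The rows in U and the columns in U carry at most #U each, so the total is at most 2#U + (card V
  -- - #U) - (#U + 2) = card V - 2, contradicting `htotal`.
  linarith

end SimpleGraph

open Finset in
/-- Every edge in the support of a point of the perfect matching polytope lies in a perfect
matching contained in the support; the matching is given as an involution. -/
theorem exists_involution_of_weight {V : Type*} [Fintype V] [DecidableEq V]
    (heven : Even (Fintype.card V))
    (w : V → V → ℚ) (hsymm : ∀ x y, w x y = w y x) (hpos : ∀ x y, 0 ≤ w x y)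
    (hdiag : ∀ x, w x x = 0) (hrow : ∀ x, ∑ y, w x y = 1)
    (hodd : ∀ C : Finset V, Odd #C → 1 ≤ ∑ x ∈ C, ∑ y ∈ Cᶜ, w x y)
    (a b : V) (hab : 0 < w a b) :
    ∃ m : V → V, Function.Involutive m ∧ (∀ x, 0 < w x (m x)) ∧ m a = b := by
  have hne : a ≠ b := by
    rintro rfl
    simp [hdiag] at hab
  let T : Finset V := {a, b}
  -- The edge ab is forced: it gets weight 1 and all other edges at a or b are dropped.
  let w' : V → V → ℚ := fun x y =>
    if x ∈ T then (if y ∈ T ∧ y ≠ x then 1 else 0) else if y ∈ T then 0 else w x y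
  let G : SimpleGraph V :=
    { Adj := fun x y => 0 < w' x y
      symm := ⟨fun x y h => by
        simp only [w'] at h ⊢
        rw [hsymm y x]
        grind⟩
      loopless := ⟨fun x h => by
        simp only [w'] at h
        split_ifs at h <;> simp_all⟩ }
  have hrowT : ∀ x ∈ T, ∑ y, w' x y = 1 := by
    intro x hx
    simp only [w', hx, if_true]
    have : (univ.filter fun y => y ∈ T ∧ y ≠ x) = T.erase x := by
      ext y; simp [and_comm]
    rw [sum_boole, this, card_erase_of_mem hx]
    simp [T, hne]
  have hrownT : ∀ x ∉ T, ∑ y, w' x y = ∑ y ∈ Tᶜ, w x y := by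
    intro x hx
    simp only [w', hx, if_false]
    rw [← sum_add_sum_compl T, sum_congr rfl (fun y hy => if_pos hy),
      sum_congr (s₁ := Tᶜ) rfl (fun y hy => if_neg (mem_compl.1 hy))]
    simp
  have hle : ∀ x (s : Finset V), ∑ y ∈ s, w x y ≤ 1 := fun x s =>
    (sum_le_sum_of_subset_of_nonneg (subset_univ _) fun y _ _ => hpos x y).trans (hrow x).le
  have hrow' : ∀ x, ∑ y, w' x y ≤ 1 := by
    intro x
    by_cases hx : x ∈ T
    · exact (hrowT x hx).le
    · rw [hrownT x hx]; exact hle x _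
  have hpos' : ∀ x y, 0 ≤ w' x y := by
    intro x y
    simp only [w']
    split_ifs <;> simp [hpos]
  have hle' : ∀ x (s : Finset V), ∑ y ∈ s, w' x y ≤ 1 := fun x s =>
    (sum_le_sum_of_subset_of_nonneg (subset_univ _) fun y _ _ => hpos' x y).trans (hrow' x)
  have hdisj : ∀ C : Finset V, Disjoint C T → ∑ x ∈ C, ∑ y ∈ C, w' x y
      = ∑ x ∈ C, ∑ y ∈ C, w x y := by
    intro C hC
    refine sum_congr rfl fun x hx => sum_congr rfl fun y hy => ?_
    simp [w', disjoint_left.1 hC hx, disjoint_left.1 hC hy]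
  have hoddle : ∀ C : Finset V, Odd #C → ∑ x ∈ C, ∑ y ∈ C, w x y ≤ #C - 1 := by
    intro C hC
    have h1 : ∑ x ∈ C, (∑ y ∈ C, w x y + ∑ y ∈ Cᶜ, w x y) = #C := by
      simp_rw [sum_add_sum_compl, hrow]; simp
    rw [sum_add_distrib] at h1
    linarith [hodd C hC]
  obtain ⟨M, hM⟩ := G.exists_isPerfectMatching_of_weight heven w'
    (fun x y => by simp only [w']; rw [hsymm x y]; grind) hpos' hrow'
    (fun x y h => lt_of_le_of_ne (hpos' x y) h.symm)
    (fun C hC => by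
      by_cases hd : Disjoint C T
      · rw [hdisj C hd]; exact hoddle C hC
      by_cases hs : T ⊆ C
      · have hc : #(C \ T) + 2 = #C := by
          rw [card_sdiff_of_subset hs]
          have := card_le_card hs
          have h2 : #T = 2 := card_pair hne
          omega
        have hC' : Odd #(C \ T) := by grind
        have h1 := hoddle _ hC'
        rw [← hdisj _ sdiff_disjoint] at h1
        have h2 : ∑ x ∈ C, ∑ y ∈ C, w' x y = ∑ x ∈ C \ T, ∑ y ∈ C \ T, w' x y
            + ∑ x ∈ T, ∑ y ∈ C, w' x y := by
          rw [← sum_sdiff hs]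
          congr 1
          refine sum_congr rfl fun x hx => ?_
          rw [← sum_sdiff hs, add_eq_left]
          refine sum_eq_zero fun y hy => ?_
          simp [w', (mem_sdiff.1 hx).2, hy]
        have h3 : ∑ x ∈ T, ∑ y ∈ C, w' x y ≤ 2 := by
          refine (sum_le_sum fun x _ => hle' x C).trans ?_
          simp [T, hne]
        have hc' : (#(C \ T) : ℚ) + 2 = #C := by exact_mod_cast hc
        linarith
      -- C contains exactly one of a, b. Its row vanishes inside C, and the other #C - 1 rows are at
      -- most 1.
      · obtain ⟨x, hxC, hxT⟩ := not_disjoint_iff.1 hd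
        have h0 : ∑ y ∈ C, w' x y = 0 := by
          refine sum_eq_zero fun y hy => ?_
          simp only [w', hxT, if_true, ite_eq_right_iff]
          rintro ⟨hyT, hyx⟩
          exfalso
          apply hs
          intro z hz
          simp only [T, mem_insert, mem_singleton] at hz hyT hxT
          grind
        rw [← add_sum_erase _ _ hxC, h0, zero_add]
        refine (sum_le_sum fun z _ => hle' z C).trans ?_
        rw [sum_const, card_erase_of_mem hxC, nsmul_eq_mul, mul_one,
          Nat.cast_sub (card_pos.2 ⟨x, hxC⟩)]
        simp)
    -- The new total is card V - 2 + 2 w(a, b): dropping the edges to T loses only 2 - 2 w(a, b)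
    -- outside T.
    (by
      have h1 : ∑ x ∈ T, ∑ y, w' x y = 2 := by
        rw [sum_congr rfl hrowT]; simp [T, hne]
      have h2 : ∑ x ∈ Tᶜ, ∑ y, w' x y = ∑ x ∈ Tᶜ, ∑ y ∈ Tᶜ, w x y :=
        sum_congr rfl fun x hx => hrownT x (mem_compl.1 hx)
      have h3 : ∑ x ∈ Tᶜ, (∑ y ∈ T, w x y + ∑ y ∈ Tᶜ, w x y) = Fintype.card V - 2 := by
        simp_rw [sum_add_sum_compl, hrow]
        have := card_add_card_compl T
        have h2 : #T = 2 := card_pair hne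
        rw [h2] at this
        rw [← this]
        simp
      rw [sum_add_distrib] at h3
      have h4 : ∑ x ∈ Tᶜ, ∑ y ∈ T, w x y + ∑ x ∈ T, ∑ y ∈ T, w x y = 2 := by
        have h4' : ∑ x ∈ Tᶜ, ∑ y ∈ T, w x y = ∑ y ∈ T, ∑ x ∈ Tᶜ, w y x := by
          rw [sum_comm]
          exact sum_congr rfl fun y _ => sum_congr rfl fun x _ => hsymm x y
        rw [h4', ← sum_add_distrib]
        simp_rw [sum_compl_add_sum, hrow]
        simp [T, hne]
      have h5 : 0 < ∑ x ∈ T, ∑ y ∈ T, w x y := by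
        simp only [T, sum_pair hne, hdiag, hsymm b a]
        linarith
      rw [← sum_add_sum_compl T, h1, h2]
      linarith)
  choose m hm hm' using fun v => hM.1 (hM.2 v)
  have hpos2 : ∀ x, 0 < w' x (m x) := fun x => M.adj_sub (hm x)
  have hT : ∀ x ∈ T, m x ∈ T ∧ m x ≠ x := by
    intro x hx
    have := hpos2 x
    simp only [w', hx, if_true] at this
    by_contra h
    simp [h] at this
  have hma : m a = b := by
    have := hT a (by simp [T])
    simpa [T, this.2] using this.1
  have hmb : m b = a := by
    have := hT b (by simp [T])
    simpa [T, this.2] using this.1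
  refine ⟨m, fun x => (hm' _ _ (hm x).symm).symm, fun x => ?_, hma⟩
  by_cases hx : x ∈ T
  · simp only [T, mem_insert, mem_singleton] at hx
    obtain rfl | rfl := hx
    · rwa [hma]
    · rwa [hmb, hsymm]
  · have := hpos2 x
    simp only [w', hx, if_false] at this
    split_ifs at this
    · simp at this
    · exact this

/-! ### The gadget graph and its odd cuts. -/

section FactorGadget

open Finset

variable {V E : Type*} [Fintype E] [DecidableEq V] [DecidableEq E]

/-- The number of half-edges at `v`, for edges with ends given by `en`. -/
def halfEdgeDegree (en : E → Bool → V) (v : V) : ℕ := #{h : E × Bool | en h.1 h.2 = v}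

/-- Edge weights on the gadget graph for subgraphs with all degrees `0` or `2`. Its vertices are two
copies of every vertex and the two half-edges of every edge. Copies of the same vertex are
adjacent, so are the halves of an edge, and a half-edge is adjacent to both copies of its end. -/
def factorGadgetWeight (en : E → Bool → V) (d : ℕ) :
    (V × Bool) ⊕ (E × Bool) → (V × Bool) ⊕ (E × Bool) → ℚ
  | .inl p, .inl q => if p.1 = q.1 ∧ p.2 ≠ q.2 then 1 - halfEdgeDegree en p.1 / d else 0
  | .inl p, .inr h => if en h.1 h.2 = p.1 then 1 / d else 0
  | .inr h, .inl p => if en h.1 h.2 = p.1 then 1 / d else 0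
  | .inr h, .inr k => if h.1 = k.1 ∧ h.2 ≠ k.2 then 1 - 2 / d else 0

theorem factorGadgetWeight_comm (en : E → Bool → V) (d : ℕ) (x y : (V × Bool) ⊕ (E × Bool)) :
    factorGadgetWeight en d x y = factorGadgetWeight en d y x := by
  rcases x with ⟨v, i⟩ | ⟨e, i⟩ <;> rcases y with ⟨u, j⟩ | ⟨f, j⟩ <;>
    simp only [factorGadgetWeight] <;> grind

theorem sum_factorGadgetWeight [Fintype V] (en : E → Bool → V) {d : ℕ} (hd : d ≠ 0)
    (x : (V × Bool) ⊕ (E × Bool)) : ∑ y, factorGadgetWeight en d x y = 1 := by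
  have hd' : (d : ℚ) ≠ 0 := by exact_mod_cast hd
  rcases x with ⟨v, i⟩ | ⟨e, i⟩
  · have h : ∑ h : E × Bool, (if en h.1 h.2 = v then (1 : ℚ) / d else 0)
        = halfEdgeDegree en v / d := by
      rw [← sum_filter, sum_const, nsmul_eq_mul, halfEdgeDegree, mul_one_div]
    simp only [Fintype.sum_sum_type, factorGadgetWeight, h]
    rw [Fintype.sum_prod_type]
    cases i <;> simp
  · simp only [Fintype.sum_sum_type, factorGadgetWeight]
    rw [Fintype.sum_prod_type, Fintype.sum_prod_type]
    cases i <;> simp <;> field_simp <;> ring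

/-- For χ an indicator function, χ x + χ y - 2 χ x χ y is 1 when x and y are separated and 0
otherwise; it collects the two ordered terms of the pair. The cut thus splits into the three kinds
of gadget edges. -/
theorem cut_factorGadgetWeight [Fintype V] (en : E → Bool → V) (d : ℕ) (χ : (V × Bool) ⊕ (E × Bool) → ℚ) :
    ∑ x, ∑ y, χ x * (1 - χ y) * factorGadgetWeight en d x y =
      ∑ v, (χ (.inl (v, false)) + χ (.inl (v, true))
          - 2 * χ (.inl (v, false)) * χ (.inl (v, true))) * (1 - halfEdgeDegree en v / d)
      + ∑ h : E × Bool, (∑ i, (χ (.inl (en h.1 h.2, i)) + χ (.inr h)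
          - 2 * χ (.inl (en h.1 h.2, i)) * χ (.inr h))) * (1 / d)
      + ∑ e, (χ (.inr (e, false)) + χ (.inr (e, true))
          - 2 * χ (.inr (e, false)) * χ (.inr (e, true))) * (1 - 2 / d) := by
  simp only [Fintype.sum_sum_type, sum_add_distrib, factorGadgetWeight]
  have h1 : ∑ p : V × Bool, ∑ q : V × Bool, χ (.inl p) * (1 - χ (.inl q)) *
      (if p.1 = q.1 ∧ p.2 ≠ q.2 then (1 : ℚ) - halfEdgeDegree en p.1 / d else 0)
      = ∑ v, (χ (.inl (v, false)) + χ (.inl (v, true))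
          - 2 * χ (.inl (v, false)) * χ (.inl (v, true))) * (1 - halfEdgeDegree en v / d) := by
    simp only [Fintype.sum_prod_type]
    refine sum_congr rfl fun v _ => ?_
    simp
    ring
  have h2 : ∑ p : E × Bool, ∑ q : E × Bool, χ (.inr p) * (1 - χ (.inr q)) *
      (if p.1 = q.1 ∧ p.2 ≠ q.2 then (1 : ℚ) - 2 / d else 0)
      = ∑ e, (χ (.inr (e, false)) + χ (.inr (e, true))
          - 2 * χ (.inr (e, false)) * χ (.inr (e, true))) * (1 - 2 / d) := by
    simp only [Fintype.sum_prod_type]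
    refine sum_congr rfl fun v _ => ?_
    simp
    ring
  have h3 : ∑ p : V × Bool, ∑ h : E × Bool, χ (.inl p) * (1 - χ (.inr h)) *
      (if en h.1 h.2 = p.1 then (1 : ℚ) / d else 0)
      + ∑ h : E × Bool, ∑ p : V × Bool, χ (.inr h) * (1 - χ (.inl p)) *
      (if en h.1 h.2 = p.1 then (1 : ℚ) / d else 0)
      = ∑ h : E × Bool, (∑ i, (χ (.inl (en h.1 h.2, i)) + χ (.inr h)
          - 2 * χ (.inl (en h.1 h.2, i)) * χ (.inr h))) * (1 / d) := by
    rw [sum_comm, ← sum_add_distrib]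
    refine sum_congr rfl fun h _ => ?_
    rw [Fintype.sum_prod_type, Fintype.sum_prod_type]
    simp only [Fintype.sum_bool, mul_ite, mul_zero]
    simp only [sum_add_distrib, sum_ite_eq, mem_univ, if_true]
    ring
  rw [← h1, ← h2, ← h3]
  ring

/-- If no edge is the only edge between two sides of a partition, then all odd sets have weight at
least `1` at their boundary. -/
theorem one_le_cut_factorGadgetWeight [Fintype V] (en : E → Bool → V) {d : ℕ} (hd : 3 ≤ d)
    (hdeg : ∀ v, halfEdgeDegree en v ≤ d)
    (hcut : ∀ (S : V → Prop) (e : E), ¬ (S (en e false) ↔ S (en e true)) →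
      ∃ f ≠ e, ¬ (S (en f false) ↔ S (en f true)))
    (C : Finset ((V × Bool) ⊕ (E × Bool))) (hC : Odd #C) :
    1 ≤ ∑ x ∈ C, ∑ y ∈ Cᶜ, factorGadgetWeight en d x y := by
  have hd0 : (0 : ℚ) < d := by exact_mod_cast (by omega : 0 < d)
  set χ : (V × Bool) ⊕ (E × Bool) → ℚ := fun x => if x ∈ C then 1 else 0 with hχ
  have hχ01 : ∀ x, χ x = 0 ∨ χ x = 1 := fun x => by
    simp only [hχ]; split_ifs <;> simp
  have hδ : ∀ x y, 0 ≤ χ x + χ y - 2 * χ x * χ y := fun x y => by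
    rcases hχ01 x with h | h <;> rcases hχ01 y with h' | h' <;> rw [h, h'] <;> norm_num
  have h0 : ∑ x ∈ C, ∑ y ∈ Cᶜ, factorGadgetWeight en d x y
      = ∑ x, ∑ y, χ x * (1 - χ y) * factorGadgetWeight en d x y := by
    rw [← sum_add_sum_compl C, sum_eq_zero (s := Cᶜ), add_zero]
    · refine sum_congr rfl fun x hx => ?_
      rw [← sum_add_sum_compl C, sum_eq_zero (s := C), zero_add]
      · refine sum_congr rfl fun y hy => ?_
        simp [hχ, hx, mem_compl.1 hy]
      · intro y hy
        simp [hχ, hy]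
    · intro x hx
      simp [hχ, mem_compl.1 hx]
  rw [h0, cut_factorGadgetWeight]
  have hdegq : ∀ v, 0 ≤ 1 - (halfEdgeDegree en v : ℚ) / d := fun v => by
    rw [sub_nonneg, div_le_one hd0]
    exact_mod_cast hdeg v
  have h2d : 3 * (1 / (d : ℚ)) ≤ 1 := by
    rw [mul_one_div, div_le_one hd0]
    exact_mod_cast hd
  set t : ℚ := 1 / d with ht
  have ht0 : 0 < t := by positivity
  have h2t : (2 : ℚ) / d = 2 * t := by rw [ht]; ring
  have hn1 : ∀ v, 0 ≤ (χ (.inl (v, false)) + χ (.inl (v, true))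
      - 2 * χ (.inl (v, false)) * χ (.inl (v, true))) * (1 - halfEdgeDegree en v / d) :=
    fun v => mul_nonneg (hδ _ _) (hdegq v)
  have hn2 : ∀ h : E × Bool, 0 ≤ (∑ i, (χ (.inl (en h.1 h.2, i)) + χ (.inr h)
      - 2 * χ (.inl (en h.1 h.2, i)) * χ (.inr h))) * t :=
    fun h => mul_nonneg (sum_nonneg fun i _ => hδ _ _) ht0.le
  have hn3 : ∀ e, 0 ≤ (χ (.inr (e, false)) + χ (.inr (e, true))
      - 2 * χ (.inr (e, false)) * χ (.inr (e, true))) * (1 - 2 / d) :=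
    fun e => mul_nonneg (hδ _ _) (by rw [h2t]; linarith)
  by_cases hcopies : ∀ v, χ (.inl (v, false)) = χ (.inl (v, true))
  · -- both copies of every vertex are on the same side
    set s : V → ℚ := fun v => χ (.inl (v, false)) with hs
    have hs01 : ∀ v, s v = 0 ∨ s v = 1 := fun v => hχ01 _
    -- A half separated from its end is cut from both copies of it, hence the factor 2t.
    let cost : E → ℚ := fun e =>
      (s (en e false) + χ (.inr (e, false)) - 2 * s (en e false) * χ (.inr (e, false))) * (2 * t)
      + (s (en e true) + χ (.inr (e, true)) - 2 * s (en e true) * χ (.inr (e, true))) * (2 * t)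
      + (χ (.inr (e, false)) + χ (.inr (e, true))
          - 2 * χ (.inr (e, false)) * χ (.inr (e, true))) * (1 - 2 * t)
    have hsum : ∑ h : E × Bool, (∑ i, (χ (.inl (en h.1 h.2, i)) + χ (.inr h)
        - 2 * χ (.inl (en h.1 h.2, i)) * χ (.inr h))) * t
        + ∑ e, (χ (.inr (e, false)) + χ (.inr (e, true))
          - 2 * χ (.inr (e, false)) * χ (.inr (e, true))) * (1 - 2 / d) = ∑ e, cost e := by
      rw [Fintype.sum_prod_type, ← sum_add_distrib]
      refine sum_congr rfl fun e _ => ?_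
      simp only [Fintype.sum_bool, ← hcopies, h2t, cost, hs]
      ring
    have hcost0 : ∀ e, 0 ≤ cost e := fun e =>
      add_nonneg (add_nonneg (mul_nonneg (hδ _ _) (by linarith)) (mul_nonneg (hδ _ _) (by linarith)))
        (mul_nonneg (hδ _ _) (by linarith))
    suffices h : 1 ≤ ∑ e, cost e by
      rw [← hsum] at h
      linarith [sum_nonneg fun v (_ : v ∈ univ) => hn1 v]
    let T : Finset E := {e | χ (.inr (e, false)) ≠ χ (.inr (e, true))}
    -- Copies contribute evenly to #C, and an edge with both halves on one side contributes 0 or 2.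
    have hT : Odd #T := by
      have h1 : #C = ∑ x, if x ∈ C then 1 else 0 := by simp
      have h2 : ∀ v, (if .inl (v, true) ∈ C then 1 else 0) + (if .inl (v, false) ∈ C then 1 else 0)
          = 2 * (if .inl (v, true) ∈ C then 1 else 0) := by
        intro v
        have := hcopies v
        by_cases h : .inl (v, true) ∈ C <;> by_cases h' : .inl (v, false) ∈ C <;>
          simp [hχ, h, h'] at this ⊢
      have h3 : ∀ e, (if .inr (e, true) ∈ C then 1 else 0) + (if .inr (e, false) ∈ C then 1 else 0)
          = (if e ∈ T then 1 else 0)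
            + 2 * (if .inr (e, true) ∈ C ∧ .inr (e, false) ∈ C then 1 else 0) := by
        intro e
        by_cases h : .inr (e, true) ∈ C <;> by_cases h' : .inr (e, false) ∈ C <;>
          simp [T, hχ, h, h']
      have h4 : #T = ∑ e, if e ∈ T then 1 else 0 := by simp
      rw [Fintype.sum_sum_type, Fintype.sum_prod_type, Fintype.sum_prod_type] at h1
      simp only [Fintype.sum_bool, h2, h3, sum_add_distrib, ← mul_sum, ← h4] at h1
      grind
    -- If the halves are split but the ends are not, exactly one half is separated from its end,
    -- adding 2t to 1 - 2t.
    have hcost_split : ∀ e ∈ T, 1 - 2 * t ≤ cost e ∧ (s (en e false) = s (en e true) → 1 ≤ cost e) := by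
      intro e he
      simp only [T, mem_filter, mem_univ, true_and] at he
      simp only [cost]
      rcases hs01 (en e false) with h1 | h1 <;> rcases hs01 (en e true) with h2 | h2 <;>
        rcases hχ01 (.inr (e, false)) with h3 | h3 <;>
        rcases hχ01 (.inr (e, true)) with h4 | h4 <;>
        rw [h3, h4] at he ⊢ <;> rw [h1, h2] <;>
        first | exact absurd rfl he | exact ⟨by linarith, fun h => by linarith⟩
    -- With the halves together and the ends apart, again exactly one half is separated from its
    -- end.
    have hcost_cut : ∀ e ∉ T, s (en e false) ≠ s (en e true) → 2 * t ≤ cost e := by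
      intro e he hse
      simp only [T, mem_filter, mem_univ, true_and, not_not] at he
      simp only [cost]
      rcases hs01 (en e false) with h1 | h1 <;> rcases hs01 (en e true) with h2 | h2 <;>
        rcases hχ01 (.inr (e, false)) with h3 | h3 <;>
        rcases hχ01 (.inr (e, true)) with h4 | h4 <;>
        rw [h3, h4] at he ⊢ <;> rw [h1, h2] at hse ⊢ <;>
        first | exact absurd rfl hse | linarith
    have hsub : ∀ A : Finset E, ∑ e ∈ A, cost e ≤ ∑ e, cost e := fun A =>
      sum_le_sum_of_subset_of_nonneg (subset_univ _) fun e _ _ => hcost0 e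
    obtain ⟨e, he⟩ := card_pos.1 hT.pos
    by_cases hse : s (en e false) = s (en e true)
    · exact ((hcost_split e he).2 hse).trans (single_le_sum (fun e _ => hcost0 e) (mem_univ e))
    have hs_iff : ∀ u v, (s u = 1 ↔ s v = 1) ↔ s u = s v := fun u v => by
      rcases hs01 u with h | h <;> rcases hs01 v with h' | h' <;> simp [h, h']
    obtain ⟨f, hfe, hf⟩ := hcut (fun v => s v = 1) e (by rwa [hs_iff])
    rw [hs_iff] at hf
    by_cases hfT : f ∈ T
    -- Oddness turns two split edges into three, and 3(1 - 2t) ≥ 1 because d ≥ 3.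
    · have h3 : 3 ≤ #T := by
        have : 1 < #T := one_lt_card.2 ⟨e, he, f, hfT, hfe.symm⟩
        grind
      have h4 : #T • (1 - 2 * t) ≤ ∑ e ∈ T, cost e :=
        card_nsmul_le_sum _ _ _ fun e he => (hcost_split e he).1
      have h5 : 3 * (1 - 2 * t) ≤ #T * (1 - 2 * t) :=
        mul_le_mul_of_nonneg_right (by exact_mod_cast h3) (by linarith)
      rw [nsmul_eq_mul] at h4
      linarith [hsub T]
    · have := hsub {e, f}
      rw [sum_pair hfe.symm] at this
      linarith [(hcost_split e he).1, hcost_cut f hfT hf]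
  -- When the copies of v are separated, each half-edge at v is cut from exactly one of them: deg v
  -- / d from these, plus 1 - deg v / d between the copies.
  · push Not at hcopies
    obtain ⟨v, hv⟩ := hcopies
    have hA : 1 - (halfEdgeDegree en v : ℚ) / d ≤ ∑ v, (χ (.inl (v, false)) + χ (.inl (v, true))
        - 2 * χ (.inl (v, false)) * χ (.inl (v, true))) * (1 - halfEdgeDegree en v / d) := by
      refine le_trans (le_of_eq ?_) (single_le_sum (fun v _ => hn1 v) (mem_univ v))
      rcases hχ01 (.inl (v, false)) with h | h <;> rcases hχ01 (.inl (v, true)) with h' | h' <;>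
        rw [h, h'] at hv ⊢ <;> simp at hv ⊢
    have hB : (halfEdgeDegree en v : ℚ) / d ≤ ∑ h : E × Bool,
        (∑ i, (χ (.inl (en h.1 h.2, i)) + χ (.inr h)
          - 2 * χ (.inl (en h.1 h.2, i)) * χ (.inr h))) * t := by
      have : (halfEdgeDegree en v : ℚ) / d = ∑ h : E × Bool with en h.1 h.2 = v, t := by
        rw [sum_const, nsmul_eq_mul, halfEdgeDegree, ht, mul_one_div]
      rw [this]
      refine le_trans (sum_le_sum fun h hh => ?_)
        (sum_le_sum_of_subset_of_nonneg (subset_univ _) fun h _ _ => hn2 h)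
      rw [(mem_filter.1 hh).2, Fintype.sum_bool]
      rcases hχ01 (.inl (v, false)) with h | h <;> rcases hχ01 (.inl (v, true)) with h' | h' <;>
        rw [h, h'] at hv ⊢ <;> simp at hv ⊢
      all_goals linarith
    linarith [sum_nonneg fun e (_ : e ∈ univ) => hn3 e]

theorem exists_involution_factorGadgetWeight [Fintype V] (en : E → Bool → V) {d : ℕ} (hd : 3 ≤ d)
    (hdeg : ∀ v, halfEdgeDegree en v ≤ d)
    (hcut : ∀ (S : V → Prop) (e : E), ¬ (S (en e false) ↔ S (en e true)) →
      ∃ f ≠ e, ¬ (S (en f false) ↔ S (en f true)))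
    (a b : (V × Bool) ⊕ (E × Bool)) (hab : 0 < factorGadgetWeight en d a b) :
    ∃ m : (V × Bool) ⊕ (E × Bool) → (V × Bool) ⊕ (E × Bool), Function.Involutive m ∧
      (∀ x, 0 < factorGadgetWeight en d x (m x)) ∧ m a = b := by
  have hd0 : (0 : ℚ) < d := by exact_mod_cast (by omega : 0 < d)
  refine exists_involution_of_weight ?_ _ (factorGadgetWeight_comm en d) ?_ ?_
    (sum_factorGadgetWeight en (by omega)) (one_le_cut_factorGadgetWeight en hd hdeg hcut) a b hab
  · simp [Fintype.card_sum, ← add_mul]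
  · have h1 : ∀ v, 0 ≤ 1 - (halfEdgeDegree en v : ℚ) / d := fun v => by
      rw [sub_nonneg, div_le_one hd0]
      exact_mod_cast hdeg v
    have h2 : 0 ≤ 1 - (2 : ℚ) / d := by
      rw [sub_nonneg, div_le_one hd0]
      exact_mod_cast (by omega : 2 ≤ d)
    have h3 : 0 ≤ (1 : ℚ) / d := by positivity
    have hite : ∀ (p : Prop) [Decidable p] (q : ℚ), 0 ≤ q → 0 ≤ if p then q else 0 :=
      fun p _ q hq => by split_ifs <;> simp [hq]
    rintro (⟨v, i⟩ | ⟨e, i⟩) (⟨u, j⟩ | ⟨f, j⟩)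
    · exact hite _ _ (h1 v)
    · exact hite _ _ h3
    · exact hite _ _ h3
    · exact hite _ _ h2
  · rintro (⟨v, i⟩ | ⟨e, i⟩) <;> simp [factorGadgetWeight]

end FactorGadget

/-! ### Reading a perfect matching of the gadget as a subgraph. -/

section FactorGadgetMatching

variable {V E : Type*} [Fintype E] [DecidableEq V] [DecidableEq E] {en : E → Bool → V} {d : ℕ}
  {m : (V × Bool) ⊕ (E × Bool) → (V × Bool) ⊕ (E × Bool)}

theorem factorGadgetWeight_inl_cases {v : V} {i : Bool} {y : (V × Bool) ⊕ (E × Bool)}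
    (h : 0 < factorGadgetWeight en d (.inl (v, i)) y) :
    y = .inl (v, !i) ∨ ∃ e j, y = .inr (e, j) ∧ en e j = v := by
  rcases y with ⟨u, j⟩ | ⟨e, j⟩ <;> simp only [factorGadgetWeight] at h <;> split_ifs at h with h'
  · left
    obtain ⟨rfl, h2⟩ := h'
    cases i <;> cases j <;> simp_all
  · simp at h
  · exact .inr ⟨e, j, rfl, h'⟩
  · simp at h

theorem factorGadgetWeight_inr_cases {e : E} {i : Bool} {y : (V × Bool) ⊕ (E × Bool)}
    (h : 0 < factorGadgetWeight en d (.inr (e, i)) y) :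
    y = .inr (e, !i) ∨ ∃ j, y = .inl (en e i, j) := by
  rcases y with ⟨u, j⟩ | ⟨f, j⟩ <;> simp only [factorGadgetWeight] at h <;> split_ifs at h with h'
  · exact .inr ⟨j, by rw [h']⟩
  · simp at h
  · left
    obtain ⟨rfl, h2⟩ := h'
    cases i <;> cases j <;> simp_all
  · simp at h

/-- A half not matched to its other half needs a copy of its end as partner. This makes the kept
edges and vertices a subgraph. -/
theorem apply_inl_ne_of_apply_inr_ne (hm : Function.Involutive m)
    (hpos : ∀ x, 0 < factorGadgetWeight en d x (m x)) {e : E}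
    (he : m (.inr (e, false)) ≠ .inr (e, true)) (i : Bool) :
    m (.inl (en e i, false)) ≠ .inl (en e i, true) := by
  intro hv
  have hv' := hm (.inl (en e i, false))
  rw [hv] at hv'
  rcases factorGadgetWeight_inr_cases (hpos (.inr (e, i))) with h | ⟨j, h⟩
  · have h' := hm (.inr (e, i))
    rw [h] at h'
    cases i <;> simp_all
  · have h' := hm (.inr (e, i))
    rw [h] at h'
    cases j <;> simp_all

/-- The two copies of v are matched to two distinct half-edges at v, and each half of a kept edge at
v is matched to one of these copies. Counting half-edges makes a loop count twice. -/
theorem card_halfEdges_eq_two (hm : Function.Involutive m)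
    (hpos : ∀ x, 0 < factorGadgetWeight en d x (m x)) {v : V}
    (hv : m (.inl (v, false)) ≠ .inl (v, true)) :
    Finset.card {h : E × Bool | m (.inr (h.1, false)) ≠ .inr (h.1, true) ∧ en h.1 h.2 = v} = 2 := by
  have hv' : m (.inl (v, true)) ≠ .inl (v, false) := fun h => hv (by rw [← h, hm])
  obtain ⟨e, i, he, hev⟩ := (factorGadgetWeight_inl_cases (hpos (.inl (v, false)))).resolve_left hv
  obtain ⟨f, j, hf, hfv⟩ := (factorGadgetWeight_inl_cases (hpos (.inl (v, true)))).resolve_left hv'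
  have he' : m (.inr (e, i)) = .inl (v, false) := by rw [← he, hm]
  have hf' : m (.inr (f, j)) = .inl (v, true) := by rw [← hf, hm]
  have hmem : ∀ {g : E} {k : Bool} {p : V × Bool}, m (.inr (g, k)) = .inl p →
      m (.inr (g, false)) ≠ .inr (g, true) := by
    intro g k p hg hg'
    cases k
    · rw [hg] at hg'; simp at hg'
    · have := hm (.inr (g, false))
      rw [hg', hg] at this
      simp at this
  rw [Finset.card_eq_two]
  refine ⟨(e, i), (f, j), ?_, ?_⟩
  · intro h
    rw [h, hf'] at he'
    simp at he'
  · ext ⟨g, k⟩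
    simp only [Finset.mem_filter, Finset.mem_univ, true_and, Finset.mem_insert,
      Finset.mem_singleton]
    constructor
    · rintro ⟨hg, rfl⟩
      have hgk : m (.inr (g, k)) ≠ .inr (g, !k) := by
        cases k
        · exact hg
        · exact fun h => hg (by rw [Bool.not_true] at h; rw [← h, hm])
      obtain ⟨l, hl⟩ := (factorGadgetWeight_inr_cases (hpos (.inr (g, k)))).resolve_left hgk
      cases l
      · left
        exact Sum.inr_injective (hm.injective (hl.trans he'.symm))
      · right
        exact Sum.inr_injective (hm.injective (hl.trans hf'.symm))
    · rintro (h | h) <;> obtain ⟨rfl, rfl⟩ := Prod.mk.inj h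
      · exact ⟨hmem he', hev⟩
      · exact ⟨hmem hf', hfv⟩

end FactorGadgetMatching

/-! ### Transfer to multigraphs. -/

namespace Graph

variable {α β : Type*} {G : Graph α β}

open Classical in
/-- The degree in a subgraph counts the half-edges at the vertex. -/
theorem degree_eq_card_halfEdges [Fintype E(G)] {en : E(G) → Bool → V(G)}
    (hen : ∀ e : E(G), G.IsLink e (en e false) (en e true)) {H : Graph α β} (hH : H ≤ G) (v : V(G)) :
    H.degree v = Finset.card {h : E(G) × Bool | (h.1 : β) ∈ E(H) ∧ en h.1 h.2 = v} := by
  set A : Bool → Finset E(G) := fun i => {e | (e : β) ∈ E(H) ∧ en e i = v} with hA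
  have h1 : Finset.card {h : E(G) × Bool | (h.1 : β) ∈ E(H) ∧ en h.1 h.2 = v}
      = (A false).card + (A true).card := by
    rw [Finset.card_filter, Fintype.sum_prod_type]
    simp only [Fintype.sum_bool, Finset.sum_add_distrib, hA, Finset.card_filter]
    rw [add_comm]
  have hlink : ∀ {e : E(G)} {x y : α}, (e : β) ∈ E(H) → (H.IsLink e x y ↔
      ((en e false : α) = x ∧ (en e true : α) = y) ∨
      ((en e false : α) = y ∧ (en e true : α) = x)) := by
    intro e x y he
    rw [IsSubgraph.isLink_iff hH he, (hen e).isLink_iff]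
  have h2 : H.incidenceSet v = Subtype.val '' ((A false ∪ A true : Finset E(G)) : Set E(G)) := by
    ext e
    simp only [mem_incidenceSet, Set.mem_image, SetLike.mem_coe, Finset.mem_union, hA,
      Finset.mem_filter, Finset.mem_univ, true_and, Subtype.exists, exists_and_right,
      exists_eq_right]
    constructor
    · rintro ⟨y, hy⟩
      have he := hy.edge_mem
      have heG := IsSubgraph.edgeSet_mono hH he
      refine ⟨heG, ?_⟩
      rcases (hlink (e := ⟨e, heG⟩) he).1 hy with ⟨h, -⟩ | ⟨-, h⟩
      · exact .inl ⟨he, Subtype.ext h⟩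
      · exact .inr ⟨he, Subtype.ext h⟩
    · rintro ⟨heG, ⟨he, h⟩ | ⟨he, h⟩⟩
      · exact ⟨_, (hlink (e := ⟨e, heG⟩) he).2 (.inl ⟨by rw [h], rfl⟩)⟩
      · exact ⟨_, (hlink (e := ⟨e, heG⟩) he).2 (.inr ⟨rfl, by rw [h]⟩)⟩
  have h3 : H.loopSet v = Subtype.val '' ((A false ∩ A true : Finset E(G)) : Set E(G)) := by
    ext e
    simp only [mem_loopSet, Set.mem_image, SetLike.mem_coe, Finset.mem_inter, hA,
      Finset.mem_filter, Finset.mem_univ, true_and, Subtype.exists, exists_and_right,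
      exists_eq_right]
    constructor
    · intro hy
      have he := hy.edge_mem
      have heG := IsSubgraph.edgeSet_mono hH he
      refine ⟨heG, ?_⟩
      have := (hlink (e := ⟨e, heG⟩) he).1 hy
      simp only [or_self] at this
      exact ⟨⟨he, Subtype.ext this.1⟩, ⟨he, Subtype.ext this.2⟩⟩
    · rintro ⟨heG, ⟨he, h⟩, -, h'⟩
      exact (hlink (e := ⟨e, heG⟩) he).2 (.inl ⟨by rw [h], by rw [h']⟩)
  rw [degree, h2, h3, h1, Set.ncard_image_of_injective _ Subtype.val_injective,
    Set.ncard_image_of_injective _ Subtype.val_injective, Set.ncard_coe_finset,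
    Set.ncard_coe_finset, Finset.card_union_add_card_inter]

open Classical in
/-- A perfect matching of the gadget graph yields a degree-`2` subgraph, which avoids exactly the
vertices whose two copies are matched to each other. -/
theorem exists_isDegreeSubgraph_of_involution [Fintype E(G)] {en : E(G) → Bool → V(G)}
    (hen : ∀ e : E(G), G.IsLink e (en e false) (en e true)) {d : ℕ}
    {m : (V(G) × Bool) ⊕ (E(G) × Bool) → (V(G) × Bool) ⊕ (E(G) × Bool)}
    (hm : Function.Involutive m) (hpos : ∀ x, 0 < factorGadgetWeight en d x (m x)) :
    ∃ H : Graph α β, H.IsDegreeSubgraph 2 G ∧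
      ∀ v : V(G), (v : α) ∈ V(H) ↔ m (.inl (v, false)) ≠ .inl (v, true) := by
  let H : Graph α β :=
    { vertexSet := {v | ∃ hv : v ∈ V(G), m (.inl (⟨v, hv⟩, false)) ≠ .inl (⟨v, hv⟩, true)}
      IsLink := fun e x y => G.IsLink e x y ∧
        ∃ he : e ∈ E(G), m (.inr (⟨e, he⟩, false)) ≠ .inr (⟨e, he⟩, true)
      isLink_symm := fun e _ => ⟨fun x y h => ⟨h.1.symm, h.2⟩⟩
      eq_or_eq_of_isLink_of_isLink := fun e x y v w h h' => h.1.left_eq_or_eq h'.1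
      left_mem_of_isLink := by
        rintro e x y ⟨h, he, hne⟩
        refine ⟨h.left_mem, ?_⟩
        obtain ⟨i, hi⟩ : ∃ i, (⟨x, h.left_mem⟩ : V(G)) = en ⟨e, he⟩ i := by
          rcases h.left_eq_or_eq (hen ⟨e, he⟩) with h' | h'
          · exact ⟨false, Subtype.ext h'⟩
          · exact ⟨true, Subtype.ext h'⟩
        rw [hi]
        exact apply_inl_ne_of_apply_inr_ne hm hpos hne i }
  have hH : H ≤ G := ⟨fun v hv => hv.1, fun e x y h => h.1⟩
  have hE : ∀ e : E(G), (e : β) ∈ E(H) ↔ m (.inr (e, false)) ≠ .inr (e, true) := by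
    intro e
    constructor
    · rintro ⟨x, y, -, he, h⟩
      exact h
    · exact fun h => ⟨_, _, hen e, e.2, h⟩
  refine ⟨H, ⟨hH, ?_⟩, fun v => ⟨fun h => h.2, fun h => ⟨v.2, h⟩⟩⟩
  rintro v ⟨hvG, hv⟩
  have := degree_eq_card_halfEdges hen hH ⟨v, hvG⟩
  simp only [hE] at this
  rw [this]
  convert! card_halfEdges_eq_two hm hpos hv

/-- In a bridgeless graph, no edge is the only edge between two sides of a partition. -/
theorem Bridgeless.exists_ne_crossing (hG : G.Bridgeless) {en : E(G) → Bool → V(G)}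
    (hen : ∀ e : E(G), G.IsLink e (en e false) (en e true)) (S : V(G) → Prop) (e : E(G))
    (he : ¬ (S (en e false) ↔ S (en e true))) :
    ∃ f ≠ e, ¬ (S (en f false) ↔ S (en f true)) := by
  by_contra! hS
  refine hG e ⟨e.2, en e false, (en e false).2, en e true, (en e true).2,
    .single ⟨e, hen e⟩, fun h => he ?_⟩
  -- If only e crossed, walks avoiding e would stay on one side, so e would be a bridge.
  have key : ∀ y, (G.deleteEdges {(e : β)}).Reachable (en e false) y →
      ∃ hy : y ∈ V(G), (S (en e false) ↔ S ⟨y, hy⟩) := by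
    intro y hy
    induction hy with
    | refl => exact ⟨(en e false).2, Iff.rfl⟩
    | tail _ hadj ih =>
      obtain ⟨hx, ih⟩ := ih
      obtain ⟨f, hf⟩ := hadj
      rw [deleteEdges_isLink] at hf
      obtain ⟨hl, hne⟩ := hf
      refine ⟨hl.right_mem, ih.trans ?_⟩
      have := hS ⟨f, hl.edge_mem⟩ (fun h => hne (by rw [← h]; rfl))
      rcases (hen ⟨f, hl.edge_mem⟩).eq_and_eq_or_eq_and_eq hl with ⟨h1, h2⟩ | ⟨h1, h2⟩
      · rwa [Subtype.ext (a1 := en _ false) (a2 := ⟨_, hx⟩) h1,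
          Subtype.ext (a1 := en _ true) (a2 := ⟨_, hl.right_mem⟩) h2] at this
      · rw [Subtype.ext (a1 := en _ true) (a2 := ⟨_, hx⟩) h2,
          Subtype.ext (a1 := en _ false) (a2 := ⟨_, hl.right_mem⟩) h1] at this
        exact this.symm
  exact (key _ h).2

end Graph

theorem proposition4p6 {α β : Type*} (G : Graph α β)
    (hV : V(G).Finite) (hE : E(G).Finite)
    (hconn : G.Connected) (hbridge : G.Bridgeless)
    (d : ℕ) (hd : 3 ≤ d) (hodd : Odd d) (hmax : G.HasMaxDegree d) :
    ∀ v ∈ G.lowDegreeSet d,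
      (∃ H : Graph α β, H.IsDegreeSubgraph 2 G ∧ v ∈ V(H) ∧ V(G) \ G.lowDegreeSet d ⊆ V(H)) ∧
      (∃ H : Graph α β, H.IsDegreeSubgraph 2 G ∧ v ∉ V(H) ∧ V(G) \ G.lowDegreeSet d ⊆ V(H)) := by
  classical
  rintro v ⟨hvG, hvd⟩
  have := hV.fintype
  have := hE.fintype
  have hends : ∀ e : E(G), ∃ x y : V(G), G.IsLink e x y := fun e => by
    obtain ⟨x, y, h⟩ := Graph.exists_isLink_of_mem_edgeSet e.2
    exact ⟨⟨x, h.left_mem⟩, ⟨y, h.right_mem⟩, h⟩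
  choose x y hxy using hends
  let en : E(G) → Bool → V(G) := fun e i => if i then y e else x e
  have hen : ∀ e : E(G), G.IsLink e (en e false) (en e true) := fun e => by simpa [en] using hxy e
  have hdeg : ∀ u : V(G), halfEdgeDegree en u = G.degree u := fun u => by
    rw [Graph.degree_eq_card_halfEdges hen le_rfl u, halfEdgeDegree]
    congr 1
    ext h
    simp
  have hdegle : ∀ u : V(G), halfEdgeDegree en u ≤ d := fun u => by
    rw [hdeg]
    exact hmax.2 ⟨u, u.2, rfl⟩
  have hd0 : (0 : ℚ) < d := by exact_mod_cast (by omega : 0 < d)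
  have key : ∀ a b, 0 < factorGadgetWeight en d a b →
      ∃ m : (V(G) × Bool) ⊕ (E(G) × Bool) → (V(G) × Bool) ⊕ (E(G) × Bool), m a = b ∧
      ∃ H : Graph α β, H.IsDegreeSubgraph 2 G ∧ V(G) \ G.lowDegreeSet d ⊆ V(H) ∧
      ∀ v : V(G), (v : α) ∈ V(H) ↔ m (.inl (v, false)) ≠ .inl (v, true) := by
    intro a b hab
    obtain ⟨m, hm, hpos, hmab⟩ := exists_involution_factorGadgetWeight en hd hdegle
      (hbridge.exists_ne_crossing hen) a b hab
    obtain ⟨H, hH, hHv⟩ := Graph.exists_isDegreeSubgraph_of_involution hen hm hpos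
    refine ⟨m, hmab, H, hH, ?_, hHv⟩
    rintro u ⟨huG, hu⟩
    rw [show u = (⟨u, huG⟩ : V(G)) from rfl, hHv]
    -- The copies of a vertex of degree d have weight 1 - d / d = 0 between them, so they cannot be
    -- matched together.
    intro h
    have hw := hpos (.inl (⟨u, huG⟩, false))
    have hdu : G.degree u = d :=
      le_antisymm (hmax.2 ⟨u, huG, rfl⟩) (not_lt.1 fun h => hu ⟨huG, h⟩)
    rw [h] at hw
    simp [factorGadgetWeight, hdeg, hdu, hd0.ne'] at hw
  constructor
  -- A half-edge at v is the start of a walk to a vertex of degree d, which differs from v.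
  · obtain ⟨e, i, hei⟩ : ∃ e i, en e i = ⟨v, hvG⟩ := by
      obtain ⟨⟨u, huG, hud⟩, -⟩ := hmax
      obtain rfl | ⟨z, ⟨e, he⟩, -⟩ := (hconn.2 v hvG u huG).cases_head
      · omega
      · rcases he.left_eq_or_eq (hen ⟨e, he.edge_mem⟩) with h | h
        · exact ⟨_, false, Subtype.ext h.symm⟩
        · exact ⟨_, true, Subtype.ext h.symm⟩
    obtain ⟨m, hm, H, hH, hsub, hHv⟩ := key (.inl (⟨v, hvG⟩, false)) (.inr (e, i)) (by
      simp only [factorGadgetWeight, hei, if_true]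
      positivity)
    refine ⟨H, hH, (hHv ⟨v, hvG⟩).2 ?_, hsub⟩
    rw [hm]
    simp
  · obtain ⟨m, hm, H, hH, hsub, hHv⟩ := key (.inl (⟨v, hvG⟩, false)) (.inl (⟨v, hvG⟩, true)) (by
      simp only [factorGadgetWeight, hdeg]
      rw [if_pos ⟨trivial, by simp⟩, sub_pos, div_lt_one hd0]
      exact_mod_cast hvd)
    exact ⟨H, hH, fun h => (hHv ⟨v, hvG⟩).1 h hm, hsub⟩
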